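/- For $q\in\mathbb C$ with $|q|<1$ write $(a;q)_\infty=\prod_{j=0}^{\infty}(1-aq^j)$, $(a;q)_k=\prod_{j=0}^{k-1}(1-aq^j)$ for $k=0,1,2,\dots$, and $[n]=[n]_q=\frac{1-q^n}{1-q}$. Theorem 3. For every $q\in\mathbb C$ with $|q|<1$, the following series converges absolutely and $$ \sum_{k=0}^{\infty}\frac{(q;q^2)_k^2\,(q;q^2)_{2k}}{(q^2;q^2)_{2k}\,(q^6;q^6)_k^2}\,[8k+1]\,q^{2k^2} =\frac{(q^3;q^2)_\infty\,(q^3;q^6)_\infty}{(q^2;q^2)_\infty\,(q^6;q^6)_\infty}. $$ -/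

import Mathlib

open scoped BigOperators

noncomputable section

/-- The finite `q`-Pochhammer symbol `(a;q)_k = ∏_{j=0}^{k-1} (1 - a q^j)`. -/
def qPoch (a q : ℂ) (k : ℕ) : ℂ := ∏ j ∈ Finset.range k, (1 - a * q ^ j)

/-- The infinite `q`-Pochhammer symbol `(a;q)_∞ = ∏_{j=0}^∞ (1 - a q^j)`, used for `|q| < 1`. -/
def qPochInf (a q : ℂ) : ℂ := ∏' j : ℕ, (1 - a * q ^ j)

/-- The `q`-number `[n] = (1 - q^n) / (1 - q)`, used for `|q| < 1`. -/
def qNumber (q : ℂ) (n : ℕ) : ℂ := (1 - q ^ n) / (1 - q)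

/-- For `|q| < 1` the infinite product in `qPochInf` converges, so that it has no default value. -/
theorem qPochInf_multipliable (a q : ℂ) (hq : ‖q‖ < 1) :
    Multipliable (fun j : ℕ => 1 - a * q ^ j) := by
  have h : Summable (fun j : ℕ => ‖-(a * q ^ j)‖) := by
    simp only [norm_neg, norm_mul, norm_pow]
    exact (summable_geometric_of_lt_one (norm_nonneg q) hq).mul_left _
  simpa only [sub_eq_add_neg] using multipliable_one_add_of_summable h

end

/-! Put p = q^2. Multiplying the k-th term by `deform q p L k` with L = p^(3n) makes the sum finite,
because the factor j = n vanishes and only k ≤ n survive. The finite sum S_n has a closed form,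
`finiteProduct q n`. As n → ∞, L → 0 and every deformation factor tends to 1; a bound independent of
n (`norm_deform_le`) allows the limit to be taken termwise, giving the series on one side and the
infinite products on the other.

S_n is evaluated by induction in the style of Wilf and Zeilberger. Let F(n,k) be the deformed term.
Raising n by one replaces L by p^3 L, and F(n+1,k) - r F(n,k) = G(k+1) - G(k), where r is
`productRatio` and G(k) is F(n+1,k) times a rational function of K = p^k (`telescoping`). Since G(0)
= 0 and G(n+1) = -F(n+1,n+1), summing over k ≤ n yields S_(n+1) = r S_n. -/

/-- The factor by which the summand is deformed so that the series terminates when `L` is a power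
of `p ^ 3`. -/
noncomputable def deform (q p L : ℂ) (k : ℕ) : ℂ :=
  ∏ j ∈ Finset.range k, ((1 - L / (p ^ j) ^ 3) * (1 - q * p * L * (p ^ j) ^ 3) /
    ((1 - L / p ^ j) * (1 - q * p * L * p ^ j)))

/-- The summand of the series. -/
noncomputable def summand (q : ℂ) (k : ℕ) : ℂ :=
  qPoch q (q ^ 2) k ^ 2 * qPoch q (q ^ 2) (2 * k) /
      (qPoch (q ^ 2) (q ^ 2) (2 * k) * qPoch (q ^ 6) (q ^ 6) k ^ 2) *
    qNumber q (8 * k + 1) * q ^ (2 * k ^ 2)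

/-- The finite product that evaluates the deformed sum. -/
noncomputable def finiteProduct (q : ℂ) (n : ℕ) : ℂ :=
  qPoch (q ^ 3) (q ^ 2) (3 * n) * qPoch (q ^ 3) (q ^ 6) n /
    (qPoch (q ^ 2) (q ^ 2) (3 * n) * qPoch (q ^ 6) (q ^ 6) n)

/-! ### Elementary bounds for finite q-Pochhammer symbols -/

theorem one_sub_pow_ne_zero_of_norm_lt_one {q : ℂ} (hq : ‖q‖ < 1) {m : ℕ} (hm : m ≠ 0) :
    1 - q ^ m ≠ 0 := by
  intro h
  have h1 : ‖q ^ m‖ = 1 := by rw [← sub_eq_zero.mp h, norm_one]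
  rw [norm_pow] at h1
  exact (pow_lt_one₀ (norm_nonneg q) hq hm).ne h1

theorem one_sub_norm_le_norm_one_sub_pow {q : ℂ} (hq : ‖q‖ < 1) {m : ℕ} (hm : m ≠ 0) :
    1 - ‖q‖ ≤ ‖1 - q ^ m‖ := by
  have h1 : ‖q ^ m‖ ≤ ‖q‖ := by
    rw [norm_pow]; exact pow_le_of_le_one (norm_nonneg q) hq.le hm
  have h2 := norm_sub_norm_le (1 : ℂ) (q ^ m)
  rw [norm_one] at h2
  linarith

theorem norm_one_sub_pow_le_two {q : ℂ} (hq : ‖q‖ < 1) (m : ℕ) : ‖1 - q ^ m‖ ≤ 2 := by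
  have h1 : ‖q ^ m‖ ≤ 1 := by
    rw [norm_pow]; exact pow_le_one₀ (norm_nonneg q) hq.le
  have h2 := norm_sub_le (1 : ℂ) (q ^ m)
  rw [norm_one] at h2
  linarith

theorem qPoch_succ (a q : ℂ) (k : ℕ) : qPoch a q (k + 1) = qPoch a q k * (1 - a * q ^ k) :=
  Finset.prod_range_succ _ _

theorem qPoch_pow_eq (q : ℂ) (a b k : ℕ) :
    qPoch (q ^ a) (q ^ b) k = ∏ j ∈ Finset.range k, (1 - q ^ (a + b * j)) := by
  simp only [qPoch, pow_add, pow_mul]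

theorem qPoch_pow_ne_zero {q : ℂ} (hq : ‖q‖ < 1) {a : ℕ} (ha : a ≠ 0) (b k : ℕ) :
    qPoch (q ^ a) (q ^ b) k ≠ 0 := by
  rw [qPoch_pow_eq]
  exact Finset.prod_ne_zero_iff.mpr fun j _ =>
    one_sub_pow_ne_zero_of_norm_lt_one hq (by omega)

theorem norm_qPoch_pow_le {q : ℂ} (hq : ‖q‖ < 1) (a b k : ℕ) :
    ‖qPoch (q ^ a) (q ^ b) k‖ ≤ 2 ^ k := by
  rw [qPoch_pow_eq, norm_prod]
  calc _ ≤ ∏ _j ∈ Finset.range k, (2 : ℝ) :=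
        Finset.prod_le_prod (fun _ _ => norm_nonneg _) fun _ _ => norm_one_sub_pow_le_two hq _
    _ = 2 ^ k := by simp

theorem le_norm_qPoch_pow {q : ℂ} (hq : ‖q‖ < 1) {a : ℕ} (ha : a ≠ 0) (b k : ℕ) :
    (1 - ‖q‖) ^ k ≤ ‖qPoch (q ^ a) (q ^ b) k‖ := by
  rw [qPoch_pow_eq, norm_prod]
  calc (1 - ‖q‖) ^ k = ∏ _j ∈ Finset.range k, (1 - ‖q‖) := by simp
    _ ≤ _ := Finset.prod_le_prod (fun _ _ => by linarith) fun _ _ =>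
        one_sub_norm_le_norm_one_sub_pow hq (by omega)

/-! ### Recurrences in k and the shift of L -/

theorem deform_succ (q p L : ℂ) (k : ℕ) :
    deform q p L (k + 1) = deform q p L k *
      ((1 - L / (p ^ k) ^ 3) * (1 - q * p * L * (p ^ k) ^ 3) /
        ((1 - L / p ^ k) * (1 - q * p * L * p ^ k))) :=
  Finset.prod_range_succ _ _

theorem summand_succ {q : ℂ} (hq : ‖q‖ < 1) (k : ℕ) {K : ℂ} (hK : K = (q ^ 2) ^ k) :
    summand q (k + 1) = summand q k *
      ((1 - q * K) ^ 2 * (1 - q * K ^ 2) * (1 - q * q ^ 2 * K ^ 2) *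
        (q ^ 2 * K ^ 2) * (1 - q * (q ^ 2) ^ 4 * K ^ 4) /
       ((1 - q ^ 2 * K ^ 2) * (1 - (q ^ 2) ^ 2 * K ^ 2) * (1 - (q ^ 2) ^ 3 * K ^ 3) ^ 2 *
        (1 - q * K ^ 4))) := by
  have e2 : 2 * (k + 1) = 2 * k + 1 + 1 := by ring
  have hp6 : (q ^ 6) ^ k = K ^ 3 := by subst hK; ring
  have hp2 : (q ^ 2) ^ (2 * k) = K ^ 2 := by subst hK; ring
  have hp21 : (q ^ 2) ^ (2 * k + 1) = q ^ 2 * K ^ 2 := by subst hK; ring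
  have hs : q ^ (2 * (k + 1) ^ 2) = q ^ (2 * k ^ 2) * (q ^ 2 * K ^ 2) := by subst hK; ring
  have hn : qNumber q (8 * k + 1) = (1 - q * K ^ 4) / (1 - q) := by
    subst hK; unfold qNumber; ring_nf
  have hn1 : qNumber q (8 * (k + 1) + 1) = (1 - q * (q ^ 2) ^ 4 * K ^ 4) / (1 - q) := by
    subst hK; unfold qNumber; ring_nf
  have n1 : 1 - q * K ^ 4 ≠ 0 := by
    have := one_sub_pow_ne_zero_of_norm_lt_one hq (m := 8 * k + 1) (by omega)
    convert this using 2; subst hK; ring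
  unfold summand
  rw [e2, qPoch_succ, qPoch_succ, qPoch_succ, qPoch_succ, qPoch_succ, qPoch_succ, hp6, hp2, hp21,
    hs, hn, hn1, ← hK]
  have h1 := qPoch_pow_ne_zero hq (a := 2) (by norm_num) 2 (2 * k)
  have h2 := qPoch_pow_ne_zero hq (a := 6) (by norm_num) 6 k
  have h3 : 1 - q ^ 2 * K ^ 2 ≠ 0 := by
    have := one_sub_pow_ne_zero_of_norm_lt_one hq (m := 4 * k + 2) (by omega)
    convert this using 2; subst hK; ring
  have h4 : 1 - q ^ 2 * (q ^ 2 * K ^ 2) ≠ 0 := by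
    have := one_sub_pow_ne_zero_of_norm_lt_one hq (m := 4 * k + 4) (by omega)
    convert this using 2; subst hK; ring
  have h5 : 1 - q ^ 6 * K ^ 3 ≠ 0 := by
    have := one_sub_pow_ne_zero_of_norm_lt_one hq (m := 6 * k + 6) (by omega)
    convert this using 2; subst hK; ring
  have h0 : 1 - q ≠ 0 := by
    simpa using one_sub_pow_ne_zero_of_norm_lt_one hq (m := 1) (by omega)
  have e4 : (q ^ 2) ^ 2 * K ^ 2 = q ^ 2 * (q ^ 2 * K ^ 2) := by ring
  have e6 : (q ^ 2) ^ 3 * K ^ 3 = q ^ 6 * K ^ 3 := by ring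
  rw [e4, e6]
  -- With every factor an atom, `field_simp` has only monomials to cancel.
  generalize qPoch (q ^ 2) (q ^ 2) (2 * k) = A at *
  generalize qPoch (q ^ 6) (q ^ 6) k = B at *
  generalize qPoch q (q ^ 2) k = C at *
  generalize qPoch q (q ^ 2) (2 * k) = D at *
  generalize q ^ (2 * k ^ 2) = E at *
  generalize hx3 : 1 - q ^ 2 * K ^ 2 = x3 at *
  generalize hx4 : 1 - q ^ 2 * (q ^ 2 * K ^ 2) = x4 at *
  generalize hx5 : 1 - q ^ 6 * K ^ 3 = x5 at *
  generalize 1 - q * K ^ 4 = x6 at *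
  generalize hx0 : 1 - q = x0 at *
  field_simp

/-- Replacing L by p^3 L moves the index by one in the products with steps p^3 and by three in those
with step p, so only boundary factors remain. Cross-multiplication avoids division by them. -/
theorem deform_shift {q p L : ℂ} (k : ℕ) (hp : p ≠ 0)
    (h1 : ∀ j < k, 1 - L / p ^ j ≠ 0) (h2 : ∀ j < k, 1 - p ^ 3 * L / p ^ j ≠ 0)
    (h3 : ∀ j < k, 1 - q * p * L * p ^ j ≠ 0)
    (h4 : ∀ j < k, 1 - q * p ^ 4 * L * p ^ j ≠ 0) {K : ℂ} (hK : K = p ^ k) :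
    deform q p L k * ((1 - q * p * L * K ^ 3) * (1 - q * p ^ 2 * L) * (1 - q * p ^ 3 * L) *
        ((1 - p * L / K) * (1 - p ^ 2 * L / K) * (1 - p ^ 3 * L / K))) =
      deform q p (p ^ 3 * L) k * ((1 - p ^ 3 * L / K ^ 3) * (1 - p * L) * (1 - p ^ 2 * L) *
        ((1 - q * p * L * K) * (1 - q * p ^ 2 * L * K) * (1 - q * p ^ 3 * L * K))) := by
  induction k generalizing K with
  | zero => subst hK; simp [deform]; ring
  | succ k ih =>
    have IH := ih (fun j hj => h1 j (by omega)) (fun j hj => h2 j (by omega))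
      (fun j hj => h3 j (by omega)) (fun j hj => h4 j (by omega)) rfl
    have a1 := h1 k (by omega)
    have a2 := h2 k (by omega)
    have a3 := h3 k (by omega)
    have a4 := h4 k (by omega)
    rw [deform_succ, deform_succ]
    have hJ : p ^ k ≠ 0 := pow_ne_zero _ hp
    have hK' : K = p * p ^ k := by rw [hK]; ring
    generalize p ^ k = J at *
    have s1 : p * L / K = L / J := by rw [hK']; field_simp
    have s2 : p ^ 2 * L / K = p * L / J := by rw [hK']; field_simp
    have s3 : p ^ 3 * L / K = p ^ 2 * L / J := by rw [hK']; field_simp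
    have s4 : p ^ 3 * L / K ^ 3 = L / J ^ 3 := by rw [hK']; field_simp
    have s5 : q * p * (p ^ 3 * L) = q * p ^ 4 * L := by ring
    have s6 : q * p * L * K ^ 3 = q * p ^ 4 * L * J ^ 3 := by rw [hK']; ring
    have s7 : q * p * L * K = q * p ^ 2 * L * J := by rw [hK']; ring
    have s8 : q * p ^ 2 * L * K = q * p ^ 3 * L * J := by rw [hK']; ring
    have s9 : q * p ^ 3 * L * K = q * p ^ 4 * L * J := by rw [hK']; ring
    rw [s1, s2, s3, s4, s5, s6, s7, s8, s9]
    generalize 1 - L / J = x1 at *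
    generalize 1 - p ^ 3 * L / J = x2 at *
    generalize 1 - q * p * L * J = x3 at *
    generalize 1 - q * p ^ 4 * L * J = x4 at *
    generalize 1 - p * L / J = y1 at *
    generalize 1 - p ^ 2 * L / J = y2 at *
    generalize 1 - L / J ^ 3 = y3 at *
    generalize 1 - p ^ 3 * L / J ^ 3 = y4 at *
    generalize 1 - q * p * L * J ^ 3 = y5 at *
    generalize 1 - q * p ^ 4 * L * J ^ 3 = y6 at *
    field_simp
    linear_combination y3 * y6 * IH

/-! ### The telescoping certificate -/

/-- The polynomial identity behind the telescoping of the deformed sum. -/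
theorem telescoping_identity (q K L : ℂ) (hq : q ≠ 0) (hK : K ≠ 0) :
    (1 - (q ^ 2) ^ 3 * L) ^ 2 * (1 - q * K ^ 4) * (1 - q * q ^ 2 * L * K ^ 3) *
        ((1 - q ^ 2 * L / K) * (1 - (q ^ 2) ^ 2 * L / K) * (1 - (q ^ 2) ^ 3 * L / K)) -
      (1 - q * q ^ 2 * L) ^ 2 * (1 - (q ^ 2) ^ 3 * L / K ^ 3) * (1 - q * K ^ 4) *
        ((1 - q * q ^ 2 * L * K) * (1 - q * (q ^ 2) ^ 2 * L * K) *
          (1 - q * (q ^ 2) ^ 3 * L * K)) =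
    -((q ^ 2) ^ 3 * L * (1 - q * (q ^ 2) ^ 4 * L ^ 2)) *
      ((1 - q * K) ^ 2 * (1 - q * K ^ 2) * (1 - q * q ^ 2 * K ^ 2) *
          (1 - (q ^ 2) ^ 3 * L / K ^ 3) * (1 - q * q ^ 2 * L * K ^ 3) / ((q ^ 2) ^ 2 * K) -
        (1 - K ^ 2) * (1 - K ^ 2 / q ^ 2) * (1 - K ^ 3) ^ 2 * (1 - q * (q ^ 2) ^ 3 * L * K) *
          (1 - q ^ 2 * L / K) / K ^ 3) := by
  field_simp
  ring

/-- The rational certificate for the telescoping of the deformed sum. -/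
noncomputable def certificate (q p L K : ℂ) : ℂ :=
  -(p ^ 3 * L * (1 - q * p ^ 4 * L ^ 2)) / (1 - p ^ 3 * L) ^ 2 *
    ((1 - K ^ 2) * (1 - K ^ 2 / p) * (1 - K ^ 3) ^ 2 * (1 - q * p ^ 3 * L * K) / K ^ 3) /
    ((1 - q * K ^ 4) * (1 - q * p * L * K ^ 3) * (1 - p ^ 2 * L / K) * (1 - p ^ 3 * L / K))

theorem certificate_one (q p L : ℂ) : certificate q p L 1 = 0 := by
  simp [certificate]

/-- The numerator of the certificate at p K cancels the denominators of the term ratio, leaving the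
first half of the bracket in `telescoping_identity`. -/
theorem certificate_step {q p L K : ℂ} (hp : p ≠ 0) (hK : K ≠ 0)
    (h1 : 1 - p ^ 2 * K ^ 2 ≠ 0) (h2 : 1 - p * K ^ 2 ≠ 0) (h3 : 1 - p ^ 3 * K ^ 3 ≠ 0)
    (h4 : 1 - q * p ^ 4 * L * K ≠ 0) (h5 : 1 - q * p ^ 4 * K ^ 4 ≠ 0)
    (h6 : 1 - q * p ^ 4 * L * K ^ 3 ≠ 0) :
    (1 - q * K) ^ 2 * (1 - q * K ^ 2) * (1 - q * p * K ^ 2) *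
        (p * K ^ 2) * (1 - q * p ^ 4 * K ^ 4) /
       ((1 - p * K ^ 2) * (1 - p ^ 2 * K ^ 2) * (1 - p ^ 3 * K ^ 3) ^ 2 * (1 - q * K ^ 4)) *
     ((1 - p ^ 3 * L / K ^ 3) * (1 - q * p * (p ^ 3 * L) * K ^ 3) /
        ((1 - p ^ 3 * L / K) * (1 - q * p * (p ^ 3 * L) * K))) * certificate q p L (p * K) =
    -(p ^ 3 * L * (1 - q * p ^ 4 * L ^ 2)) / (1 - p ^ 3 * L) ^ 2 *
      ((1 - q * K) ^ 2 * (1 - q * K ^ 2) * (1 - q * p * K ^ 2) * (1 - p ^ 3 * L / K ^ 3) /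
        (p ^ 2 * K)) /
      ((1 - q * K ^ 4) * ((1 - p * L / K) * (1 - p ^ 2 * L / K) * (1 - p ^ 3 * L / K))) := by
  unfold certificate
  have s1 : (p * K) ^ 2 = p ^ 2 * K ^ 2 := by ring
  have s2 : p ^ 2 * K ^ 2 / p = p * K ^ 2 := by field_simp
  have s3 : (p * K) ^ 3 = p ^ 3 * K ^ 3 := by ring
  have s4 : q * p ^ 3 * L * (p * K) = q * p ^ 4 * L * K := by ring
  have s5 : q * (p * K) ^ 4 = q * p ^ 4 * K ^ 4 := by ring
  have s6 : q * p * L * (p ^ 3 * K ^ 3) = q * p ^ 4 * L * K ^ 3 := by ring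
  have s7 : p ^ 2 * L / (p * K) = p * L / K := by field_simp
  have s8 : p ^ 3 * L / (p * K) = p ^ 2 * L / K := by field_simp
  have s9 : q * p * (p ^ 3 * L) = q * p ^ 4 * L := by ring
  rw [s5, s1, s2, s3, s4, s6, s7, s8, s9]
  generalize 1 - p ^ 2 * K ^ 2 = x1 at *
  generalize 1 - p * K ^ 2 = x2 at *
  generalize 1 - p ^ 3 * K ^ 3 = x3 at *
  generalize 1 - q * p ^ 4 * L * K = x4 at *
  generalize 1 - q * p ^ 4 * K ^ 4 = x5 at *
  generalize 1 - q * p ^ 4 * L * K ^ 3 = x6 at *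
  generalize (1 - q * K) = x7 at *
  generalize (1 - q * K ^ 2) = x8 at *
  generalize (1 - q * p * K ^ 2) = x9 at *
  generalize (1 - q * K ^ 4) = y1 at *
  generalize (1 - p * L / K) = y2 at *
  generalize (1 - p ^ 2 * L / K) = y3 at *
  generalize (1 - p ^ 3 * L / K) = y4 at *
  generalize (1 - p ^ 3 * L / K ^ 3) = y5 at *
  generalize -(p ^ 3 * L * (1 - q * p ^ 4 * L ^ 2)) / (1 - p ^ 3 * L) ^ 2 = y6 at *
  -- These four factors sit in denominators on both sides; if one vanishes, both sides are 0 because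
  -- x / 0 = 0.
  by_cases hy1 : y1 = 0
  · simp [hy1]
  by_cases hy2 : y2 = 0
  · simp [hy2]
  by_cases hy3 : y3 = 0
  · simp [hy3]
  by_cases hy4 : y4 = 0
  · simp [hy4]
  field_simp

/-! ### Recurrence in n and the finite evaluation -/

/-- The ratio of consecutive values of `finiteProduct`. -/
noncomputable def productRatio (q p L : ℂ) : ℂ :=
  (1 - q * p * L) ^ 2 * (1 - q * p ^ 2 * L) * (1 - q * p ^ 3 * L) /
    ((1 - p * L) * (1 - p ^ 2 * L) * (1 - p ^ 3 * L) ^ 2)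

theorem finiteProduct_succ (q : ℂ) (n : ℕ) :
    finiteProduct q (n + 1) = finiteProduct q n * productRatio q (q ^ 2) ((q ^ 2) ^ (3 * n)) := by
  have e : 3 * (n + 1) = 3 * n + 1 + 1 + 1 := by ring
  have s1 : q ^ 3 * (q ^ 2) ^ (3 * n) = q * q ^ 2 * (q ^ 2) ^ (3 * n) := by ring
  have s2 : q ^ 3 * (q ^ 2) ^ (3 * n + 1) = q * (q ^ 2) ^ 2 * (q ^ 2) ^ (3 * n) := by ring
  have s3 : q ^ 3 * (q ^ 2) ^ (3 * n + 1 + 1) = q * (q ^ 2) ^ 3 * (q ^ 2) ^ (3 * n) := by ring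
  have s4 : q ^ 3 * (q ^ 6) ^ n = q * q ^ 2 * (q ^ 2) ^ (3 * n) := by ring
  have s5 : q ^ 2 * (q ^ 2) ^ (3 * n + 1) = (q ^ 2) ^ 2 * (q ^ 2) ^ (3 * n) := by ring
  have s6 : q ^ 2 * (q ^ 2) ^ (3 * n + 1 + 1) = (q ^ 2) ^ 3 * (q ^ 2) ^ (3 * n) := by ring
  have s7 : q ^ 6 * (q ^ 6) ^ n = (q ^ 2) ^ 3 * (q ^ 2) ^ (3 * n) := by ring
  unfold finiteProduct productRatio
  rw [e]
  simp only [qPoch_succ]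
  rw [s1, s2, s3, s4, s5, s6, s7, div_mul_div_comm]
  congr 1 <;> ring

theorem one_sub_ne_zero_of_eq_pow {q x : ℂ} (hq : ‖q‖ < 1) (m : ℕ) (hm : m ≠ 0)
    (hx : x = q ^ m) : 1 - x ≠ 0 :=
  hx ▸ one_sub_pow_ne_zero_of_norm_lt_one hq hm

theorem pow_mul_pow_div_pow {q : ℂ} (hq : q ≠ 0) {a b n j : ℕ} (h : j ≤ a + b * n) :
    (q ^ 2) ^ a * (q ^ 2) ^ (b * n) / (q ^ 2) ^ j = q ^ (2 * (a + b * n - j)) := by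
  rw [div_eq_iff (pow_ne_zero _ (pow_ne_zero _ hq)), ← pow_add, ← pow_mul, ← pow_mul, ← pow_add]
  congr 1
  omega

theorem telescoping {q : ℂ} (hq : ‖q‖ < 1) (hq0 : q ≠ 0) {n k : ℕ} (hk : k ≤ n) {L : ℂ}
    (hL : L = (q ^ 2) ^ (3 * n)) :
    summand q k * deform q (q ^ 2) ((q ^ 2) ^ 3 * L) k -
        productRatio q (q ^ 2) L * (summand q k * deform q (q ^ 2) L k) =
      summand q (k + 1) * deform q (q ^ 2) ((q ^ 2) ^ 3 * L) (k + 1) *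
          certificate q (q ^ 2) L ((q ^ 2) ^ (k + 1)) -
        summand q k * deform q (q ^ 2) ((q ^ 2) ^ 3 * L) k *
          certificate q (q ^ 2) L ((q ^ 2) ^ k) := by
  have hp0 : q ^ 2 ≠ 0 := pow_ne_zero _ hq0
  have hsh := deform_shift (q := q) (p := q ^ 2) (L := L) k hp0
    (fun j hj => one_sub_ne_zero_of_eq_pow hq (2 * (0 + 3 * n - j)) (by omega) (by
      rw [← pow_mul_pow_div_pow hq0 (by omega), hL, pow_zero, one_mul]))
    (fun j hj => one_sub_ne_zero_of_eq_pow hq (2 * (3 + 3 * n - j)) (by omega) (by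
      rw [← pow_mul_pow_div_pow hq0 (by omega), hL]))
    (fun j hj => one_sub_ne_zero_of_eq_pow hq (3 + 6 * n + 2 * j) (by omega) (by
      rw [hL]; ring))
    (fun j hj => one_sub_ne_zero_of_eq_pow hq (9 + 6 * n + 2 * j) (by omega) (by
      rw [hL]; ring)) rfl
  have d1 : 1 - q ^ 2 * L / (q ^ 2) ^ k ≠ 0 :=
    one_sub_ne_zero_of_eq_pow hq (2 * (1 + 3 * n - k)) (by omega) (by
      rw [← pow_mul_pow_div_pow hq0 (by omega), hL, pow_one])
  have d2 : 1 - (q ^ 2) ^ 2 * L / (q ^ 2) ^ k ≠ 0 :=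
    one_sub_ne_zero_of_eq_pow hq (2 * (2 + 3 * n - k)) (by omega) (by
      rw [← pow_mul_pow_div_pow hq0 (by omega), hL])
  have d3 : 1 - (q ^ 2) ^ 3 * L / (q ^ 2) ^ k ≠ 0 :=
    one_sub_ne_zero_of_eq_pow hq (2 * (3 + 3 * n - k)) (by omega) (by
      rw [← pow_mul_pow_div_pow hq0 (by omega), hL])
  have hK0 : (q ^ 2) ^ k ≠ 0 := pow_ne_zero _ hp0
  have hcs := certificate_step (q := q) (p := q ^ 2) (L := L) hp0 hK0
    (one_sub_ne_zero_of_eq_pow hq (4 + 4 * k) (by omega) (by ring))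
    (one_sub_ne_zero_of_eq_pow hq (2 + 4 * k) (by omega) (by ring))
    (one_sub_ne_zero_of_eq_pow hq (6 + 6 * k) (by omega) (by ring))
    (one_sub_ne_zero_of_eq_pow hq (9 + 6 * n + 2 * k) (by omega) (by rw [hL]; ring))
    (one_sub_ne_zero_of_eq_pow hq (9 + 8 * k) (by omega) (by ring))
    (one_sub_ne_zero_of_eq_pow hq (9 + 6 * n + 6 * k) (by omega) (by rw [hL]; ring))
  have d4 : 1 - q * ((q ^ 2) ^ k) ^ 4 ≠ 0 :=
    one_sub_ne_zero_of_eq_pow hq (1 + 8 * k) (by omega) (by ring)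
  have d5 : 1 - q * q ^ 2 * L * ((q ^ 2) ^ k) ^ 3 ≠ 0 :=
    one_sub_ne_zero_of_eq_pow hq (3 + 6 * n + 6 * k) (by omega) (by rw [hL]; ring)
  have d6 : 1 - q ^ 2 * L ≠ 0 :=
    one_sub_ne_zero_of_eq_pow hq (2 + 6 * n) (by omega) (by rw [hL]; ring)
  have d7 : 1 - (q ^ 2) ^ 2 * L ≠ 0 :=
    one_sub_ne_zero_of_eq_pow hq (4 + 6 * n) (by omega) (by rw [hL]; ring)
  have d8 : 1 - (q ^ 2) ^ 3 * L ≠ 0 :=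
    one_sub_ne_zero_of_eq_pow hq (6 + 6 * n) (by omega) (by rw [hL]; ring)
  have d9 : 1 - q * (q ^ 2) ^ 2 * L ≠ 0 :=
    one_sub_ne_zero_of_eq_pow hq (5 + 6 * n) (by omega) (by rw [hL]; ring)
  have d10 : 1 - q * (q ^ 2) ^ 3 * L ≠ 0 :=
    one_sub_ne_zero_of_eq_pow hq (7 + 6 * n) (by omega) (by rw [hL]; ring)
  have hs := summand_succ hq k rfl
  have hd := deform_succ q (q ^ 2) ((q ^ 2) ^ 3 * L) k
  have hp1 : (q ^ 2) ^ (k + 1) = q ^ 2 * (q ^ 2) ^ k := by ring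
  have hid := telescoping_identity q ((q ^ 2) ^ k) L hq0 hK0
  rw [hs, hd, hp1]
  generalize (q ^ 2) ^ k = K at *
  generalize summand q k = W at *
  generalize deform q (q ^ 2) L k = V at *
  generalize deform q (q ^ 2) ((q ^ 2) ^ 3 * L) k = V' at *
  have hV : V = V' * ((1 - (q ^ 2) ^ 3 * L / K ^ 3) * (1 - q ^ 2 * L) * (1 - (q ^ 2) ^ 2 * L) *
        ((1 - q * q ^ 2 * L * K) * (1 - q * (q ^ 2) ^ 2 * L * K) *
          (1 - q * (q ^ 2) ^ 3 * L * K))) /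
      ((1 - q * q ^ 2 * L * K ^ 3) * (1 - q * (q ^ 2) ^ 2 * L) * (1 - q * (q ^ 2) ^ 3 * L) *
        ((1 - q ^ 2 * L / K) * (1 - (q ^ 2) ^ 2 * L / K) * (1 - (q ^ 2) ^ 3 * L / K))) := by
    rw [eq_div_iff, hsh]
    simp only [ne_eq, mul_eq_zero, not_or]
    tauto
  -- This is the telescoping relation with the common factor W * V' removed.
  have key : 1 - productRatio q (q ^ 2) L * (((1 - (q ^ 2) ^ 3 * L / K ^ 3) * (1 - q ^ 2 * L) *
        (1 - (q ^ 2) ^ 2 * L) *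
        ((1 - q * q ^ 2 * L * K) * (1 - q * (q ^ 2) ^ 2 * L * K) *
          (1 - q * (q ^ 2) ^ 3 * L * K))) /
      ((1 - q * q ^ 2 * L * K ^ 3) * (1 - q * (q ^ 2) ^ 2 * L) * (1 - q * (q ^ 2) ^ 3 * L) *
        ((1 - q ^ 2 * L / K) * (1 - (q ^ 2) ^ 2 * L / K) * (1 - (q ^ 2) ^ 3 * L / K)))) =
      -((q ^ 2) ^ 3 * L * (1 - q * (q ^ 2) ^ 4 * L ^ 2)) / (1 - (q ^ 2) ^ 3 * L) ^ 2 *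
      ((1 - q * K) ^ 2 * (1 - q * K ^ 2) * (1 - q * q ^ 2 * K ^ 2) *
        (1 - (q ^ 2) ^ 3 * L / K ^ 3) / ((q ^ 2) ^ 2 * K)) /
      ((1 - q * K ^ 4) *
        ((1 - q ^ 2 * L / K) * (1 - (q ^ 2) ^ 2 * L / K) * (1 - (q ^ 2) ^ 3 * L / K))) -
      certificate q (q ^ 2) L K := by
    unfold productRatio certificate
    -- The last factor is moved out of each fraction so that what remains matches the expressions
    -- abstracted as `Y1` and `Y2`.
    have e1 : ∀ a b c d e : ℂ, a * b * c * d * e / ((q ^ 2) ^ 2 * K) =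
        a * b * c * d / ((q ^ 2) ^ 2 * K) * e := fun _ _ _ _ _ => by ring
    have e2 : ∀ a b c d e : ℂ, a * b * c * d * e / K ^ 3 =
        a * b * c * d / K ^ 3 * e := fun _ _ _ _ _ => by ring
    rw [e1, e2] at hid
    generalize (1 - q * K) ^ 2 * (1 - q * K ^ 2) * (1 - q * q ^ 2 * K ^ 2) *
        (1 - (q ^ 2) ^ 3 * L / K ^ 3) / ((q ^ 2) ^ 2 * K) = Y1 at *
    generalize (1 - K ^ 2) * (1 - K ^ 2 / q ^ 2) * (1 - K ^ 3) ^ 2 *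
      (1 - q * (q ^ 2) ^ 3 * L * K) / K ^ 3 = Y2 at *
    generalize (q ^ 2) ^ 3 * L * (1 - q * (q ^ 2) ^ 4 * L ^ 2) = Y3 at *
    generalize 1 - q ^ 2 * L / K = x1 at *
    generalize 1 - (q ^ 2) ^ 2 * L / K = x2 at *
    generalize 1 - (q ^ 2) ^ 3 * L / K = x3 at *
    generalize 1 - q * K ^ 4 = x4 at *
    generalize 1 - q * q ^ 2 * L * K ^ 3 = x5 at *
    generalize 1 - q ^ 2 * L = x6 at *
    generalize 1 - (q ^ 2) ^ 2 * L = x7 at *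
    generalize 1 - (q ^ 2) ^ 3 * L = x8 at *
    generalize 1 - q * (q ^ 2) ^ 2 * L = x9 at *
    generalize 1 - q * (q ^ 2) ^ 3 * L = x10 at *
    generalize 1 - q * q ^ 2 * L = x11 at *
    generalize 1 - (q ^ 2) ^ 3 * L / K ^ 3 = x12 at *
    generalize 1 - q * q ^ 2 * L * K = x13 at *
    generalize 1 - q * (q ^ 2) ^ 2 * L * K = x14 at *
    generalize 1 - q * (q ^ 2) ^ 3 * L * K = x15 at *
    clear hcs hs hd hsh hV
    field_simp
    linear_combination hid
  rw [hV]
  rw [← hcs] at key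
  linear_combination W * V' * key

/-- Here K^3 = p^3 L, so 1 - K^2 = 1 - p^3 L / K, 1 - K^2 / p = 1 - p^2 L / K, and the other factors
pair off likewise; only the sign is left. -/
theorem certificate_last {q : ℂ} (hq : ‖q‖ < 1) (hq0 : q ≠ 0) (n : ℕ) :
    certificate q (q ^ 2) ((q ^ 2) ^ (3 * n)) ((q ^ 2) ^ (n + 1)) = -1 := by
  have hL : (q ^ 2) ^ (3 * n) = ((q ^ 2) ^ n) ^ 3 := by ring
  have hK : (q ^ 2) ^ (n + 1) = q ^ 2 * (q ^ 2) ^ n := by ring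
  have d1 : 1 - (q ^ 2) ^ 3 * ((q ^ 2) ^ n) ^ 3 ≠ 0 :=
    one_sub_ne_zero_of_eq_pow hq (6 + 6 * n) (by omega) (by ring)
  have d2 : 1 - (q ^ 2) ^ 2 * ((q ^ 2) ^ n) ^ 2 ≠ 0 :=
    one_sub_ne_zero_of_eq_pow hq (4 + 4 * n) (by omega) (by ring)
  have d3 : 1 - q ^ 2 * ((q ^ 2) ^ n) ^ 2 ≠ 0 :=
    one_sub_ne_zero_of_eq_pow hq (2 + 4 * n) (by omega) (by ring)
  have d4 : 1 - q * (q ^ 2) ^ 4 * ((q ^ 2) ^ n) ^ 4 ≠ 0 :=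
    one_sub_ne_zero_of_eq_pow hq (9 + 8 * n) (by omega) (by ring)
  have d5 : 1 - q * (q ^ 2) ^ 4 * (((q ^ 2) ^ n) ^ 3) ^ 2 ≠ 0 :=
    one_sub_ne_zero_of_eq_pow hq (9 + 12 * n) (by omega) (by ring)
  have hM0 : (q ^ 2) ^ n ≠ 0 := pow_ne_zero _ (pow_ne_zero _ hq0)
  rw [hL, hK]
  unfold certificate
  generalize (q ^ 2) ^ n = M at *
  have s1 : (q ^ 2 * M) ^ 2 / q ^ 2 = q ^ 2 * M ^ 2 := by field_simp
  have s2 : (q ^ 2 * M) ^ 2 = (q ^ 2) ^ 2 * M ^ 2 := by ring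
  have s3 : (q ^ 2 * M) ^ 3 = (q ^ 2) ^ 3 * M ^ 3 := by ring
  have s4 : q * (q ^ 2) ^ 3 * M ^ 3 * (q ^ 2 * M) = q * (q ^ 2) ^ 4 * M ^ 4 := by ring
  have s5 : q * (q ^ 2 * M) ^ 4 = q * (q ^ 2) ^ 4 * M ^ 4 := by ring
  have s6 : q * q ^ 2 * M ^ 3 * ((q ^ 2) ^ 3 * M ^ 3) = q * (q ^ 2) ^ 4 * (M ^ 3) ^ 2 := by ring
  have s7 : (q ^ 2) ^ 2 * M ^ 3 / (q ^ 2 * M) = q ^ 2 * M ^ 2 := by field_simp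
  have s8 : (q ^ 2) ^ 3 * M ^ 3 / (q ^ 2 * M) = (q ^ 2) ^ 2 * M ^ 2 := by field_simp
  rw [s5, s1, s2, s3, s4, s6, s7, s8]
  generalize 1 - (q ^ 2) ^ 3 * M ^ 3 = x1 at *
  generalize 1 - (q ^ 2) ^ 2 * M ^ 2 = x2 at *
  generalize 1 - q ^ 2 * M ^ 2 = x3 at *
  generalize 1 - q * (q ^ 2) ^ 4 * M ^ 4 = x4 at *
  generalize 1 - q * (q ^ 2) ^ 4 * (M ^ 3) ^ 2 = x5 at *
  field_simp

theorem sum_summand_mul_deform {q : ℂ} (hq : ‖q‖ < 1) (hq0 : q ≠ 0) (n : ℕ) :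
    ∑ k ∈ Finset.range (n + 1), summand q k * deform q (q ^ 2) ((q ^ 2) ^ (3 * n)) k =
      finiteProduct q n := by
  induction n with
  | zero =>
    have h1 : 1 - q ≠ 0 := by
      simpa using one_sub_pow_ne_zero_of_norm_lt_one hq (m := 1) (by omega)
    simp [summand, deform, finiteProduct, qPoch, qNumber, h1]
  | succ n ih =>
    have hL : (q ^ 2) ^ (3 * (n + 1)) = (q ^ 2) ^ 3 * (q ^ 2) ^ (3 * n) := by ring
    rw [finiteProduct_succ, ← ih, hL, Finset.sum_range_succ]
    have h := Finset.sum_congr (rfl : Finset.range (n + 1) = Finset.range (n + 1))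
      fun k hk => telescoping hq hq0 (Nat.lt_succ_iff.mp (Finset.mem_range.mp hk)) rfl
    -- The upper boundary term is minus the term k = n + 1, which the sum over k ≤ n omits.
    rw [Finset.sum_sub_distrib, ← Finset.mul_sum, Finset.sum_range_sub
      (fun k => summand q k * deform q (q ^ 2) ((q ^ 2) ^ 3 * (q ^ 2) ^ (3 * n)) k *
          certificate q (q ^ 2) ((q ^ 2) ^ (3 * n)) ((q ^ 2) ^ k)), certificate_last hq hq0,
      pow_zero, certificate_one] at h
    linear_combination h

/-! ### Limits and dominated convergence -/

open Filter Topology in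
theorem tendsto_qPoch {q : ℂ} (a : ℂ) (hq : ‖q‖ < 1) :
    Tendsto (qPoch a q) atTop (𝓝 (qPochInf a q)) :=
  (qPochInf_multipliable a q hq).hasProd.tendsto_prod_nat

theorem qPochInf_pow_ne_zero {q : ℂ} (hq : ‖q‖ < 1) {a b : ℕ} (ha : a ≠ 0) (hb : b ≠ 0) :
    qPochInf (q ^ a) (q ^ b) ≠ 0 := by
  have hqb : ‖q ^ b‖ < 1 := by
    rw [norm_pow]; exact pow_lt_one₀ (norm_nonneg q) hq hb
  have h : Summable (fun j : ℕ => ‖-(q ^ a * (q ^ b) ^ j)‖) := by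
    simp only [norm_neg, norm_mul, norm_pow _ (_ : ℕ)]
    rw [← norm_pow q b]
    exact (summable_geometric_of_lt_one (norm_nonneg _) hqb).mul_left _
  have := tprod_one_add_ne_zero_of_summable (f := fun j : ℕ => -(q ^ a * (q ^ b) ^ j)) (fun j => by
    rw [← sub_eq_add_neg]
    exact one_sub_ne_zero_of_eq_pow hq (a + b * j) (by omega) (by ring)) h
  simpa only [qPochInf, sub_eq_add_neg] using this

open Filter Topology in
theorem tendsto_finiteProduct {q : ℂ} (hq : ‖q‖ < 1) :
    Tendsto (finiteProduct q) atTop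
      (𝓝 (qPochInf (q ^ 3) (q ^ 2) * qPochInf (q ^ 3) (q ^ 6) /
        (qPochInf (q ^ 2) (q ^ 2) * qPochInf (q ^ 6) (q ^ 6)))) := by
  have h2 : ‖q ^ 2‖ < 1 := by
    rw [norm_pow]; exact pow_lt_one₀ (norm_nonneg q) hq two_ne_zero
  have h6 : ‖q ^ 6‖ < 1 := by
    rw [norm_pow]; exact pow_lt_one₀ (norm_nonneg q) hq (by norm_num)
  have h3 : Tendsto (fun n : ℕ => 3 * n) atTop atTop :=
    tendsto_id.const_mul_atTop' (by norm_num)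
  exact (((tendsto_qPoch _ h2).comp h3).mul (tendsto_qPoch _ h6)).div
    (((tendsto_qPoch _ h2).comp h3).mul (tendsto_qPoch _ h6))
    (mul_ne_zero (qPochInf_pow_ne_zero hq (by norm_num) (by norm_num))
      (qPochInf_pow_ne_zero hq (by norm_num) (by norm_num)))

open Filter Topology in
theorem summable_pow_mul_pow_sq {A r : ℝ} (hA : 0 < A) (hr0 : 0 < r) (hr : r < 1) :
    Summable (fun k : ℕ => A ^ k * r ^ (2 * k ^ 2)) := by
  refine summable_of_ratio_test_tendsto_lt_one (l := 0) one_pos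
    (Eventually.of_forall fun k => by positivity) ?_
  have h : ∀ k : ℕ, ‖A ^ (k + 1) * r ^ (2 * (k + 1) ^ 2)‖ / ‖A ^ k * r ^ (2 * k ^ 2)‖ =
      A * r ^ 2 * (r ^ 4) ^ k := by
    intro k
    rw [Real.norm_of_nonneg (by positivity), Real.norm_of_nonneg (by positivity),
      div_eq_iff (by positivity)]
    ring
  simp only [h]
  simpa using (tendsto_pow_atTop_nhds_zero_of_lt_one (by positivity : 0 ≤ r ^ 4)
    (pow_lt_one₀ hr0.le hr (by norm_num))).const_mul (A * r ^ 2)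

/-- Crude bounds on each factor suffice: they cost only C^k, which the Gaussian decay of ‖q‖^(2k^2)
absorbs. -/
theorem norm_summand_le {q : ℂ} (hq : ‖q‖ < 1) (k : ℕ) :
    ‖summand q k‖ ≤
      2 / (1 - ‖q‖) * ((16 / (1 - ‖q‖) ^ 4) ^ k * ‖q‖ ^ (2 * k ^ 2)) := by
  have hr : 0 < 1 - ‖q‖ := by linarith
  have a1 := norm_qPoch_pow_le hq 1 2 k
  have a2 := norm_qPoch_pow_le hq 1 2 (2 * k)
  rw [pow_one] at a1 a2
  have b1 := le_norm_qPoch_pow hq (a := 2) (by norm_num) 2 (2 * k)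
  have b2 := le_norm_qPoch_pow hq (a := 6) (by norm_num) 6 k
  have c1 := norm_one_sub_pow_le_two hq (8 * k + 1)
  have c2 : 1 - ‖q‖ ≤ ‖1 - q‖ := by
    simpa using one_sub_norm_le_norm_one_sub_pow hq (m := 1) one_ne_zero
  unfold summand qNumber
  rw [norm_mul, norm_mul, norm_div, norm_div, norm_mul, norm_mul, norm_pow, norm_pow, norm_pow]
  calc _ ≤ (2 ^ k) ^ 2 * 2 ^ (2 * k) / ((1 - ‖q‖) ^ (2 * k) * ((1 - ‖q‖) ^ k) ^ 2) *
        (2 / (1 - ‖q‖)) * ‖q‖ ^ (2 * k ^ 2) := by gcongr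
    _ = _ := by
      rw [div_pow, ← pow_mul, ← pow_mul, ← pow_mul, ← pow_add, ← pow_add,
        show (16 : ℝ) = 2 ^ 4 by norm_num, ← pow_mul, show k * 2 + 2 * k = 4 * k by ring,
        show 2 * k + k * 2 = 4 * k by ring]
      ring

theorem norm_deform_le {q : ℂ} (hq : ‖q‖ < 1) (hq0 : q ≠ 0) (n k : ℕ) :
    ‖deform q (q ^ 2) ((q ^ 2) ^ (3 * n)) k‖ ≤ (4 / (1 - ‖q‖) ^ 2) ^ k := by
  have hr : 0 < 1 - ‖q‖ := by linarith
  by_cases hk : n < k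
  · have : deform q (q ^ 2) ((q ^ 2) ^ (3 * n)) k = 0 := by
      -- The factor j = n contains 1 - L / p^(3n) = 0. For n = 0 its denominator vanishes too, and 0
      -- / 0 = 0 still gives zero.
      refine Finset.prod_eq_zero (Finset.mem_range.mpr hk) ?_
      rw [← pow_mul (q ^ 2) n 3, mul_comm n 3,
        div_self (pow_ne_zero _ (pow_ne_zero _ hq0))]
      simp
    rw [this, norm_zero]
    positivity
  · unfold deform
    rw [norm_prod]
    calc _ ≤ ∏ _j ∈ Finset.range k, 4 / (1 - ‖q‖) ^ 2 := by
          refine Finset.prod_le_prod (fun _ _ => norm_nonneg _) fun j hj => ?_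
          rw [Finset.mem_range] at hj
          have e1 : (q ^ 2) ^ (3 * n) / ((q ^ 2) ^ j) ^ 3 = q ^ (2 * (0 + 3 * n - 3 * j)) := by
            rw [← pow_mul_pow_div_pow hq0 (by omega), pow_zero, one_mul, ← pow_mul (q ^ 2) j 3,
              mul_comm j 3]
          have e2 : (q ^ 2) ^ (3 * n) / (q ^ 2) ^ j = q ^ (2 * (0 + 3 * n - j)) := by
            rw [← pow_mul_pow_div_pow hq0 (by omega), pow_zero, one_mul]
          have e3 : q * q ^ 2 * (q ^ 2) ^ (3 * n) * ((q ^ 2) ^ j) ^ 3 =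
            q ^ (3 + 6 * n + 6 * j) := by ring
          have e4 : q * q ^ 2 * (q ^ 2) ^ (3 * n) * (q ^ 2) ^ j = q ^ (3 + 6 * n + 2 * j) := by
            ring
          rw [e1, e2, e3, e4, norm_div, norm_mul, norm_mul,
            show (4 : ℝ) = 2 * 2 by norm_num, sq]
          have b1 := one_sub_norm_le_norm_one_sub_pow hq
            (m := 2 * (0 + 3 * n - j)) (by omega)
          have b2 := one_sub_norm_le_norm_one_sub_pow hq
            (m := 3 + 6 * n + 2 * j) (by omega)
          gcongr
          · exact norm_one_sub_pow_le_two hq _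
          · exact norm_one_sub_pow_le_two hq _
      _ = _ := by rw [Finset.prod_const, Finset.card_range]

open Filter Topology in
theorem tendsto_deform {q : ℂ} (hq : ‖q‖ < 1) (k : ℕ) :
    Tendsto (fun n : ℕ => deform q (q ^ 2) ((q ^ 2) ^ (3 * n)) k) atTop (𝓝 1) := by
  have h2 : ‖(q ^ 2) ^ 3‖ < 1 := by
    rw [← pow_mul, norm_pow]; exact pow_lt_one₀ (norm_nonneg q) hq (by norm_num)
  have hL : Tendsto (fun n : ℕ => (q ^ 2) ^ (3 * n)) atTop (𝓝 0) := by
    simp only [pow_mul (q ^ 2) 3]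
    exact tendsto_pow_atTop_nhds_zero_of_norm_lt_one h2
  have hd : ContinuousAt (fun L => deform q (q ^ 2) L k) 0 := by
    unfold deform
    refine tendsto_finsetProd _ fun j _ => ContinuousAt.div (by fun_prop) (by fun_prop) ?_
    simp
  simpa [deform, ContinuousAt, Function.comp_def] using hd.tendsto.comp hL

open Filter Topology in
theorem hasSum_summand {q : ℂ} (hq : ‖q‖ < 1) (hq0 : q ≠ 0) :
    HasSum (summand q)
      (qPochInf (q ^ 3) (q ^ 2) * qPochInf (q ^ 3) (q ^ 6) /
        (qPochInf (q ^ 2) (q ^ 2) * qPochInf (q ^ 6) (q ^ 6))) := by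
  have hr : 0 < 1 - ‖q‖ := by linarith
  have hr0 : 0 < ‖q‖ := norm_pos_iff.mpr hq0
  have hs : Summable (summand q) := Summable.of_norm_bounded
    ((summable_pow_mul_pow_sq (by positivity) hr0 hq).mul_left _) (norm_summand_le hq)
  have hlim : Tendsto
      (fun n : ℕ => ∑' k, summand q k * deform q (q ^ 2) ((q ^ 2) ^ (3 * n)) k) atTop
      (𝓝 (∑' k, summand q k)) := by
    refine tendsto_tsum_of_dominated_convergence
      (bound := fun k => 2 / (1 - ‖q‖) *
        ((16 / (1 - ‖q‖) ^ 4 * (4 / (1 - ‖q‖) ^ 2)) ^ k * ‖q‖ ^ (2 * k ^ 2)))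
      ((summable_pow_mul_pow_sq (by positivity) hr0 hq).mul_left _) (fun k => ?_)
      (Eventually.of_forall fun n k => ?_)
    · simpa using (tendsto_deform hq k).const_mul (summand q k)
    · rw [norm_mul]
      refine (mul_le_mul (norm_summand_le hq k) (norm_deform_le hq hq0 n k) (norm_nonneg _)
        (by positivity)).trans_eq ?_
      rw [mul_pow]
      ring
  have hfin : ∀ n : ℕ, ∑' k, summand q k * deform q (q ^ 2) ((q ^ 2) ^ (3 * n)) k =
      finiteProduct q n := by
    intro n
    rw [← sum_summand_mul_deform hq hq0 n]
    refine tsum_eq_sum fun k hk => mul_eq_zero_of_right _ ?_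
    refine Finset.prod_eq_zero (i := n) (by simpa [Nat.succ_le_iff] using hk) ?_
    rw [← pow_mul (q ^ 2) n 3, mul_comm n 3, div_self (pow_ne_zero _ (pow_ne_zero _ hq0))]
    simp
  simp only [hfin] at hlim
  rw [tendsto_nhds_unique (tendsto_finiteProduct hq) hlim]
  exact hs.hasSum

theorem theorem3 (q : ℂ) (hq : ‖q‖ < 1) :
    HasSum
      (fun k : ℕ =>
        qPoch q (q ^ 2) k ^ 2 * qPoch q (q ^ 2) (2 * k) /
            (qPoch (q ^ 2) (q ^ 2) (2 * k) * qPoch (q ^ 6) (q ^ 6) k ^ 2) *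
          qNumber q (8 * k + 1) * q ^ (2 * k ^ 2))
      (qPochInf (q ^ 3) (q ^ 2) * qPochInf (q ^ 3) (q ^ 6) /
        (qPochInf (q ^ 2) (q ^ 2) * qPochInf (q ^ 6) (q ^ 6))) := by
  rcases eq_or_ne q 0 with rfl | hq0
  -- At q = 0 the deformation would divide by powers of 0, but q^(2k^2) already kills every term
  -- with k > 0.
  · convert hasSum_single (0 : ℕ) fun k hk => ?_ using 1
    · simp [qPoch, qPochInf, qNumber]
    · simp [hk]
  · exact hasSum_summand hq hq0
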